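/- Let $\mathcal X$ be a Hausdorff space with a Borel probability measure $\mu$, and let $d:\mathcal X\times\mathcal X\to[0,\infty)$ be continuous with $d(x,x)=0$ and $d(x,y)=d(y,x)$ for all $x,y$. Let $r\ge 0$. A finite sequence $(s_1,\dots,s_k)$ in $\mathcal X$ has the $r$-local-separation property if there is $y\in\mathcal X$ with $d(s_i,y)\le r$ for all $i$, and $d(s_i,s_j)>r$ for all $1\le i<j\le k$. For $\mathbf x=(x_1,\dots,x_n)\in\mathcal X^n$ let $h(\mathbf x,r)$ be the length of the longest subsequence of $\mathbf x$ with the $r$-local-separation property; assume that $h(\cdot,r)$ is measurable with respect to the completion of the product measure $\mu^n$. Let $\mathbf X=(X_1,\dots,X_n)$ be a vector of independent random variables with law $\mu$. Then for every $t>0$: (i) $\mathbb P\left\{\sqrt{\mathbb E[h(\mathbf X,r)]}\le\sqrt{h(\mathbf X,r)}+\sqrt{2t}\right\}\ge 1-e^{-t}$; (ii) $\mathbb P\left\{h(\mathbf X,r)-2\,\mathbb E[h(\mathbf X,r)]>t\right\}\le e^{-6t/7}$. -/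

import Mathlib

open MeasureTheory ProbabilityTheory

/-- The `r`-local-separation property of a finite sequence `s = (s₁, …, s_k)` in a space with
distortion function `d`: all the points lie in the ball of radius `r` about a common point of the
space (locality), and they are mutually more than `r` apart (separation). -/
def IsLocallySeparated {𝒳 : Type*} (d : 𝒳 → 𝒳 → ℝ) (r : ℝ) {k : ℕ} (s : Fin k → 𝒳) : Prop :=
  (∃ y : 𝒳, ∀ i, d (s i) y ≤ r) ∧ ∀ i j, i < j → r < d (s i) (s j)

/-- The lengths of the subsequences of `x = (x₁, …, x_n)` with the `r`-local-separation property. A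
subsequence of length `k` is given by a strictly increasing map from `Fin k` to `Fin n`. -/
def locallySeparatedLengths {𝒳 : Type*} (d : 𝒳 → 𝒳 → ℝ) (r : ℝ) {n : ℕ} (x : Fin n → 𝒳) : Set ℕ :=
  {k | ∃ σ : Fin k ↪o Fin n, IsLocallySeparated d r (x ∘ σ)}

/-- The empirical local packing number `h(x, r)`: the length of the longest subsequence
of `x = (x₁, …, x_n)` with the `r`-local-separation property. -/
noncomputable def localPackingNumber {𝒳 : Type*} (d : 𝒳 → 𝒳 → ℝ) {n : ℕ} (x : Fin n → 𝒳)
    (r : ℝ) : ℕ :=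
  sSup (locallySeparatedLengths d r x)

/-- The supremum in the definition of `localPackingNumber` is a maximum. -/
theorem localPackingNumber_isGreatest {𝒳 : Type*} [Nonempty 𝒳] (d : 𝒳 → 𝒳 → ℝ) {n : ℕ}
    (x : Fin n → 𝒳) (r : ℝ) :
    IsGreatest (locallySeparatedLengths d r x) (localPackingNumber d x r) := by
  have hb : BddAbove (locallySeparatedLengths d r x) := by
    refine ⟨n, ?_⟩
    rintro k ⟨σ, -⟩
    simpa using Fintype.card_le_of_injective σ σ.injective
  have h0 : (locallySeparatedLengths d r x).Nonempty := by
    refine ⟨0, OrderEmbedding.ofIsEmpty, ⟨Classical.arbitrary 𝒳, fun i => i.elim0⟩, fun i => i.elim0⟩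
  exact ⟨Nat.sSup_mem h0 hb, fun k hk => le_csSup hb hk⟩

/-! Deleting the k-th entry lowers h by at most one, and only if every longest locally separated
subsequence uses index k. The losses therefore sum to at most h: h is self-bounding
(`isSelfBounding_localPackingNumber`). The entropy method does the rest. With G(l) = log E e^{lh},
tensorization (`entropy_le_sum`) turns self-bounding into (1 - e^{-l}) G'(l) ≤ G(l)
(`IsSelfBounding.entropy_exp_le`). This integrates to G(l) ≤ (e^l - 1) E h
(`le_exp_sub_one_mul_of_deriv_le`), and Chernoff bounds give both tails (`poissonian_tails`). Since
h is only a.e. measurable and h with an entry deleted may not be measurable at all, tensorization is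
applied to a measurable version of h and the integer parts of its coordinate means
(`IsSelfBounding.ae_floor_coordMean`). -/

/-! ### Bounded measurable functions. -/

section BoundedMeasurable

variable {β : Type*} [MeasurableSpace β] {F G : β → ℝ}

/-- A real function that is measurable and bounded. -/
def IsBoundedMeasurable (F : β → ℝ) : Prop :=
  Measurable F ∧ ∃ C, ∀ x, |F x| ≤ C

namespace IsBoundedMeasurable

theorem of_mem_Icc (hF : Measurable F) {a b : ℝ} (h : ∀ x, F x ∈ Set.Icc a b) :
    IsBoundedMeasurable F :=
  ⟨hF, max |a| |b|, fun x => abs_le_max_abs_abs (h x).1 (h x).2⟩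

theorem integrable (hF : IsBoundedMeasurable F) (ν : Measure β) [IsFiniteMeasure ν] :
    Integrable F ν := by
  obtain ⟨hm, C, hC⟩ := hF
  exact Integrable.of_bound hm.aestronglyMeasurable C (ae_of_all _ hC)

theorem mul (hF : IsBoundedMeasurable F) (hG : IsBoundedMeasurable G) :
    IsBoundedMeasurable fun x => F x * G x := by
  obtain ⟨hF, C, hC⟩ := hF
  obtain ⟨hG, D, hD⟩ := hG
  refine ⟨hF.mul hG, C * D, fun x => ?_⟩
  rw [abs_mul]
  exact mul_le_mul (hC x) (hD x) (abs_nonneg _) ((abs_nonneg _).trans (hC x))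

theorem add (hF : IsBoundedMeasurable F) (hG : IsBoundedMeasurable G) :
    IsBoundedMeasurable fun x => F x + G x := by
  obtain ⟨hF, C, hC⟩ := hF
  obtain ⟨hG, D, hD⟩ := hG
  exact ⟨hF.add hG, C + D, fun x => (abs_add_le _ _).trans (add_le_add (hC x) (hD x))⟩

theorem sub (hF : IsBoundedMeasurable F) (hG : IsBoundedMeasurable G) :
    IsBoundedMeasurable fun x => F x - G x := by
  obtain ⟨hF, C, hC⟩ := hF
  obtain ⟨hG, D, hD⟩ := hG
  exact ⟨hF.sub hG, C + D, fun x => (abs_sub _ _).trans (add_le_add (hC x) (hD x))⟩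

theorem log (hF : Measurable F) {a b : ℝ} (ha : 0 < a) (h : ∀ x, F x ∈ Set.Icc a b) :
    IsBoundedMeasurable fun x => Real.log (F x) :=
  of_mem_Icc hF.log (a := Real.log a) (b := Real.log b) fun x =>
    ⟨Real.log_le_log ha (h x).1, Real.log_le_log (ha.trans_le (h x).1) (h x).2⟩

theorem inv (hF : Measurable F) {a b : ℝ} (ha : 0 < a) (h : ∀ x, F x ∈ Set.Icc a b) :
    IsBoundedMeasurable fun x => (F x)⁻¹ :=
  of_mem_Icc hF.inv (a := 0) (b := a⁻¹) fun x =>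
    ⟨inv_nonneg.2 (ha.le.trans (h x).1), inv_anti₀ ha (h x).1⟩

theorem comp {γ : Type*} [MeasurableSpace γ] {u : γ → β} (hF : IsBoundedMeasurable F)
    (hu : Measurable u) : IsBoundedMeasurable fun x => F (u x) :=
  ⟨hF.1.comp hu, hF.2.imp fun _ h x => h (u x)⟩

end IsBoundedMeasurable

end BoundedMeasurable

/-! ### Product measures and tensorization of entropy. -/

section Product

variable {ι α : Type*} [Fintype ι] [DecidableEq ι] [MeasurableSpace α]
  (μ : Measure α) [IsProbabilityMeasure μ]

/-- Resampling one coordinate of a product measure preserves it. -/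
theorem measurePreserving_update_pi (k : ι) :
    MeasurePreserving (fun p : (ι → α) × α => Function.update p.1 k p.2)
      ((Measure.pi fun _ : ι => μ).prod μ) (Measure.pi fun _ : ι => μ) := by
  have hm : Measurable (fun p : (ι → α) × α => Function.update p.1 k p.2) := by
    refine measurable_pi_lambda _ fun j => ?_
    by_cases h : j = k
    · subst h; simpa using measurable_snd
    · simpa [h, Function.comp_def] using
        (measurable_pi_apply (X := fun _ : ι => α) j).comp measurable_fst
  refine ⟨hm, (Measure.pi_eq fun s hs => ?_).symm⟩
  rw [Measure.map_apply hm (MeasurableSet.univ_pi hs)]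
  have : (fun p : (ι → α) × α => Function.update p.1 k p.2) ⁻¹' (Set.univ.pi s) =
      (Set.univ.pi (Function.update s k Set.univ)) ×ˢ s k := by
    ext p
    simp only [Set.mem_preimage, Set.mem_pi, Set.mem_univ, true_imp_iff, Set.mem_prod]
    constructor
    · refine fun h => ⟨fun j => ?_, by simpa using h k⟩
      by_cases hj : j = k
      · subst hj; simp
      · simpa [hj] using h j
    · rintro ⟨h1, h2⟩ j
      by_cases hj : j = k
      · subst hj; simpa using h2
      · simpa [hj] using h1 j
  rw [this, Measure.prod_prod, Measure.pi_pi, ← Finset.mul_prod_erase _ _ (Finset.mem_univ k),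
    ← Finset.mul_prod_erase Finset.univ (fun i => μ (s i)) (Finset.mem_univ k), mul_comm]
  simp only [Function.update_self, measure_univ, one_mul]
  congr 1
  refine Finset.prod_congr rfl fun j hj => ?_
  rw [Function.update_of_ne (Finset.ne_of_mem_erase hj)]

/-- The mean of `Z` over the `k`-th coordinate. -/
noncomputable def coordMean (k : ι) (Z : (ι → α) → ℝ) (x : ι → α) : ℝ :=
  ∫ y, Z (Function.update x k y) ∂μ


variable {μ} {Z : (ι → α) → ℝ}

omit [IsProbabilityMeasure μ] [Fintype ι] in
theorem coordMean_update (k : ι) (Z : (ι → α) → ℝ) (x : ι → α) (y : α) :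
    coordMean μ k Z (Function.update x k y) = coordMean μ k Z x := by
  simp [coordMean]

theorem measurable_coordMean (k : ι) (hZ : Measurable Z) : Measurable (coordMean μ k Z) := by
  have h := (hZ.comp (measurePreserving_update_pi μ k).measurable).stronglyMeasurable
  exact (h.integral_prod_right' (ν := μ)).measurable

omit [Fintype ι] in
theorem isBoundedMeasurable_comp_update (k : ι) (hZ : IsBoundedMeasurable Z) (x : ι → α) :
    IsBoundedMeasurable fun y => Z (Function.update x k y) :=
  hZ.comp (measurable_update x)

omit [Fintype ι] in
theorem coordMean_mem_Icc (k : ι) (hZ : Measurable Z) {a b : ℝ} (h : ∀ x, Z x ∈ Set.Icc a b)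
    (x : ι → α) : coordMean μ k Z x ∈ Set.Icc a b := by
  have hi := (isBoundedMeasurable_comp_update k (.of_mem_Icc hZ h) x).integrable μ
  constructor
  · simpa [coordMean] using integral_mono (integrable_const a) hi fun y => (h _).1
  · simpa [coordMean] using integral_mono hi (integrable_const b) fun y => (h _).2

theorem integral_coordMean (k : ι) (hZ : IsBoundedMeasurable Z) :
    ∫ x, coordMean μ k Z x ∂(Measure.pi fun _ : ι => μ) = ∫ x, Z x ∂(Measure.pi fun _ : ι => μ) := by
  have hp := measurePreserving_update_pi μ k
  conv_rhs => rw [← hp.map_eq, integral_map hp.measurable.aemeasurable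
    hZ.1.aestronglyMeasurable]
  rw [integral_prod _ ((hZ.comp hp.measurable).integrable _)]
  rfl

/-- A function that does not depend on the `k`-th coordinate may be pulled out of the mean. -/
theorem integral_mul_coordMean (k : ι) {c : (ι → α) → ℝ} (hc : IsBoundedMeasurable c)
    (hck : ∀ x y, c (Function.update x k y) = c x) (hZ : IsBoundedMeasurable Z) :
    ∫ x, c x * coordMean μ k Z x ∂(Measure.pi fun _ : ι => μ) =
      ∫ x, c x * Z x ∂(Measure.pi fun _ : ι => μ) := by
  rw [← integral_coordMean k (hc.mul hZ)]
  simp [coordMean, hck, integral_const_mul]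

/-- This is log u ≤ u - 1 at u = cz/(wy), multiplied by y. When w is a coordinate mean of z, and c
does not depend on that coordinate, the last term integrates to the integral of c. -/
theorem mul_log_sub_log_le {y z w c : ℝ} (hy : 0 < y) (hz : 0 < z) (hw : 0 < w) (hc : 0 < c) :
    y * (Real.log z - Real.log w) ≤ y * (Real.log y - Real.log c) - y + c * w⁻¹ * z := by
  have h := Real.log_le_sub_one_of_pos (x := c * w⁻¹ * z / y) (by positivity)
  rw [Real.log_div (by positivity) hy.ne', Real.log_mul (by positivity) hz.ne',
    Real.log_mul hc.ne' (by positivity), Real.log_inv] at h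
  have h2 := mul_le_mul_of_nonneg_left h hy.le
  have h3 : y * (c * w⁻¹ * z / y - 1) = c * w⁻¹ * z - y := by field_simp
  linarith

/-- Z is Y averaged over the coordinates in S, one at a time. The differences of logarithms
telescope, and averaging over k costs at most the k-th summand. -/
theorem exists_partialMean {Y : (ι → α) → ℝ} (hY : Measurable Y) {a b : ℝ} (ha : 0 < a)
    (hYab : ∀ x, Y x ∈ Set.Icc a b) {c : ι → (ι → α) → ℝ} (hc : ∀ k, Measurable (c k))
    (hcab : ∀ k x, c k x ∈ Set.Icc a b)
    (hck : ∀ k x y, c k (Function.update x k y) = c k x) (S : Finset ι) :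
    ∃ Z : (ι → α) → ℝ, Measurable Z ∧ (∀ x, Z x ∈ Set.Icc a b) ∧ DependsOn Z (↑S)ᶜ ∧
      ∫ x, Z x ∂(Measure.pi fun _ : ι => μ) = ∫ x, Y x ∂(Measure.pi fun _ : ι => μ) ∧
      ∫ x, Y x * (Real.log (Y x) - Real.log (Z x)) ∂(Measure.pi fun _ : ι => μ) ≤
        ∑ k ∈ S, ∫ x, (Y x * (Real.log (Y x) - Real.log (c k x)) - Y x + c k x)
          ∂(Measure.pi fun _ : ι => μ) := by
  induction S using Finset.induction_on with
  | empty =>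
    refine ⟨Y, hY, hYab, ?_, rfl, by simp⟩
    intro x y h
    exact congrArg Y (funext fun i => h i (by simp))
  | insert k S hk ih =>
    obtain ⟨Z, hZ, hZab, hdep, hint, hle⟩ := ih
    have hW := measurable_coordMean (μ := μ) k hZ
    have hWab := coordMean_mem_Icc (μ := μ) k hZ hZab
    refine ⟨coordMean μ k Z, hW, hWab, ?_,
      (integral_coordMean k (.of_mem_Icc hZ hZab)).trans hint, ?_⟩
    · intro x y h
      refine integral_congr_ae (ae_of_all _ fun u => hdep fun i hi => ?_)
      by_cases hik : i = k
      · subst hik; simp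
      · simp only [Function.update_of_ne hik]
        exact h i (by simpa [hik] using hi)
    · have bY := IsBoundedMeasurable.of_mem_Icc hY hYab
      have bZ := IsBoundedMeasurable.of_mem_Icc hZ hZab
      have bc := IsBoundedMeasurable.of_mem_Icc (hc k) (hcab k)
      have lY := IsBoundedMeasurable.log hY ha hYab
      have lZ := IsBoundedMeasurable.log hZ ha hZab
      have lW := IsBoundedMeasurable.log hW ha hWab
      have lc := IsBoundedMeasurable.log (hc k) ha (hcab k)
      have bcW := bc.mul (IsBoundedMeasurable.inv hW ha hWab)
      have hpos : ∀ {F : (ι → α) → ℝ}, (∀ x, F x ∈ Set.Icc a b) → ∀ x, 0 < F x :=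
        fun h x => ha.trans_le (h x).1
      -- The factor c/W, W the mean of Z over k, is free of coordinate k, so Z may be replaced by W,
      -- which cancels.
      have hcZ : ∫ x, c k x * (coordMean μ k Z x)⁻¹ * Z x ∂(Measure.pi fun _ : ι => μ) =
          ∫ x, c k x ∂(Measure.pi fun _ : ι => μ) := by
        rw [← integral_mul_coordMean k bcW (fun x y => by rw [hck, coordMean_update]) bZ]
        refine integral_congr_ae (ae_of_all _ fun x => ?_)
        exact inv_mul_cancel_right₀ (hpos hWab x).ne' _
      have hstep : ∫ x, Y x * (Real.log (Z x) - Real.log (coordMean μ k Z x))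
            ∂(Measure.pi fun _ : ι => μ) ≤
          ∫ x, (Y x * (Real.log (Y x) - Real.log (c k x)) - Y x + c k x)
            ∂(Measure.pi fun _ : ι => μ) := by
        have b1 := (bY.mul (lY.sub lc)).sub bY
        calc _ ≤ ∫ x, (Y x * (Real.log (Y x) - Real.log (c k x)) - Y x +
              c k x * (coordMean μ k Z x)⁻¹ * Z x) ∂(Measure.pi fun _ : ι => μ) :=
              integral_mono ((bY.mul (lZ.sub lW)).integrable _)
                ((b1.add (bcW.mul bZ)).integrable _) fun x =>
                mul_log_sub_log_le (hpos hYab x) (hpos hZab x) (hpos hWab x) (hpos (hcab k) x)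
          _ = _ := by
              rw [integral_add (b1.integrable _) ((bcW.mul bZ).integrable _), hcZ,
                integral_add (b1.integrable _) (bc.integrable _)]
      rw [Finset.sum_insert hk]
      refine le_trans (le_of_eq ?_) (add_le_add hstep hle)
      rw [← integral_add ((bY.mul (lZ.sub lW)).integrable _) ((bY.mul (lY.sub lZ)).integrable _)]
      refine integral_congr_ae (ae_of_all _ fun x => ?_)
      ring

/-- Tensorization of the entropy on a product space, with the one-coordinate entropies bounded by
their variational formula. -/
theorem entropy_le_sum {Y : (ι → α) → ℝ} (hY : Measurable Y) {a b : ℝ} (ha : 0 < a)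
    (hYab : ∀ x, Y x ∈ Set.Icc a b) {c : ι → (ι → α) → ℝ} (hc : ∀ k, Measurable (c k))
    (hcab : ∀ k x, c k x ∈ Set.Icc a b)
    (hck : ∀ k x y, c k (Function.update x k y) = c k x) :
    ∫ x, Y x * Real.log (Y x) ∂(Measure.pi fun _ : ι => μ) -
      (∫ x, Y x ∂(Measure.pi fun _ : ι => μ)) *
        Real.log (∫ x, Y x ∂(Measure.pi fun _ : ι => μ)) ≤
      ∑ k, ∫ x, (Y x * (Real.log (Y x) - Real.log (c k x)) - Y x + c k x)
        ∂(Measure.pi fun _ : ι => μ) := by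
  obtain ⟨Z, hZ, hZab, hdep, hint, hle⟩ :=
    exists_partialMean (μ := μ) hY ha hYab hc hcab hck Finset.univ
  refine le_trans (le_of_eq ?_) hle
  have bY := IsBoundedMeasurable.of_mem_Icc hY hYab
  have lY := IsBoundedMeasurable.log hY ha hYab
  -- After averaging over all coordinates Z depends on none of them, so it equals its own integral.
  have hZc : ∀ x, Z x = ∫ x, Y x ∂(Measure.pi fun _ : ι => μ) := by
    intro x
    rw [← hint]
    have : ∀ y, Z y = Z x := fun y => hdep fun i hi => by simp at hi
    simp [this]
  simp_rw [hZc, mul_sub]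
  rw [integral_sub ((bY.mul lY).integrable _) ((bY.integrable _).mul_const _), integral_mul_const]

end Product

/-! ### From a differential inequality to Poissonian tails. -/

/-- The hypothesis makes G(s)/(e^s - 1) antitone on each side of 0, where its limit is G'(0). For l
< 0 the factor e^l - 1 is negative and reverses the comparison. -/
theorem le_exp_sub_one_mul_of_deriv_le {G G' : ℝ → ℝ} (hG : ∀ l, HasDerivAt G (G' l) l)
    (h0 : G 0 = 0) (h : ∀ l, (1 - Real.exp (-l)) * G' l ≤ G l) (l : ℝ) :
    G l ≤ (Real.exp l - 1) * G' 0 := by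
  set H : ℝ → ℝ := fun s => G s / (Real.exp s - 1) with hH
  have hne : ∀ s : ℝ, s ≠ 0 → Real.exp s - 1 ≠ 0 := fun s hs => by
    simpa [sub_eq_zero] using hs
  have hd : ∀ s, s ≠ 0 → HasDerivAt H
      ((G' s * (Real.exp s - 1) - G s * Real.exp s) / (Real.exp s - 1) ^ 2) s := fun s hs =>
    (hG s).div ((Real.hasDerivAt_exp s).sub_const 1) (hne s hs)
  have hd' : ∀ s, s ≠ 0 → deriv H s ≤ 0 := fun s hs => by
    rw [(hd s hs).deriv]
    refine div_nonpos_of_nonpos_of_nonneg ?_ (sq_nonneg _)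
    have h1 := mul_le_mul_of_nonneg_left (h s) (Real.exp_pos s).le
    have h2 : Real.exp s * Real.exp (-s) = 1 := by rw [← Real.exp_add]; simp
    have h3 : Real.exp s * ((1 - Real.exp (-s)) * G' s) =
        (Real.exp s - Real.exp s * Real.exp (-s)) * G' s := by ring
    rw [h3, h2] at h1
    linarith
  have hlim : Filter.Tendsto H (nhdsWithin 0 {0}ᶜ) (nhds (G' 0)) := by
    have h1 := hasDerivAt_iff_tendsto_slope.1 (hG 0)
    have h2 := hasDerivAt_iff_tendsto_slope.1 (Real.hasDerivAt_exp 0)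
    have h3 := h1.div h2 (by simp)
    simp only [Real.exp_zero, div_one] at h3
    refine h3.congr' ?_
    filter_upwards [self_mem_nhdsWithin] with s hs
    have hs : s ≠ 0 := hs
    have := hne s hs
    simp only [Pi.div_apply, slope_def_field, h0, sub_zero, Real.exp_zero, hH]
    field_simp
  rcases lt_trichotomy l 0 with hl | rfl | hl
  · have hanti : AntitoneOn H (Set.Iio 0) := by
      refine antitoneOn_of_deriv_nonpos (convex_Iio 0)
        (fun s hs => (hd s (ne_of_lt hs)).continuousAt.continuousWithinAt) ?_ ?_
      · rw [interior_Iio]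
        exact fun s hs => (hd s (ne_of_lt hs)).differentiableAt.differentiableWithinAt
      · rw [interior_Iio]
        exact fun s hs => hd' s (ne_of_lt hs)
    have hle : G' 0 ≤ H l := by
      refine le_of_tendsto (hlim.mono_left (nhdsWithin_mono 0 (s := Set.Iio 0) fun s hs => ne_of_lt hs)) ?_
      filter_upwards [Ioo_mem_nhdsLT hl] with s hs
      exact hanti hl hs.2 hs.1.le
    have hneg : Real.exp l - 1 < 0 := by simpa using hl
    rw [hH, le_div_iff_of_neg hneg] at hle
    linarith
  · simp [h0]
  · have hanti : AntitoneOn H (Set.Ioi 0) := by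
      refine antitoneOn_of_deriv_nonpos (convex_Ioi 0)
        (fun s hs => (hd s (ne_of_gt hs)).continuousAt.continuousWithinAt) ?_ ?_
      · rw [interior_Ioi]
        exact fun s hs => (hd s (ne_of_gt hs)).differentiableAt.differentiableWithinAt
      · rw [interior_Ioi]
        exact fun s hs => hd' s (ne_of_gt hs)
    have hle : H l ≤ G' 0 := by
      refine ge_of_tendsto (hlim.mono_left (nhdsWithin_mono 0 (s := Set.Ioi 0) fun s hs => ne_of_gt hs)) ?_
      filter_upwards [Ioo_mem_nhdsGT hl] with s hs
      exact hanti hs.1 hl hs.2.le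
    have hpos : 0 < Real.exp l - 1 := by simpa using hl
    rw [hH, div_le_iff₀ hpos] at hle
    linarith

/-- Poissonian tails of a nonnegative bounded variable `V` whose moment generating function is at
most that of the Poisson law with the same mean. -/
theorem poissonian_tails {Ω : Type*} [MeasurableSpace Ω] {P : Measure Ω} [IsProbabilityMeasure P]
    {V : Ω → ℝ} (h0 : ∀ ω, 0 ≤ V ω)
    (hint : ∀ l : ℝ, Integrable (fun ω => Real.exp (l * V ω)) P)
    (hmgf : ∀ l : ℝ, mgf V P l ≤ Real.exp ((Real.exp l - 1) * ∫ ω, V ω ∂P)) {t : ℝ} (ht : 0 < t) :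
    1 - Real.exp (-t) ≤ P.real {ω | √(∫ ω', V ω' ∂P) ≤ √(V ω) + √(2 * t)} ∧
    P.real {ω | V ω - 2 * ∫ ω', V ω' ∂P > t} ≤ Real.exp (-(6 * t / 7)) := by
  set E := ∫ ω, V ω ∂P with hE
  have hE0 : 0 ≤ E := integral_nonneg h0
  constructor
  · set A := {ω | √E ≤ √(V ω) + √(2 * t)} with hA
    have hAc : P.real Aᶜ ≤ Real.exp (-t) := by
      by_cases hEt : √E ≤ √(2 * t)
      · have : Aᶜ = ∅ := by
          rw [Set.compl_empty_iff, Set.eq_univ_iff_forall]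
          intro ω
          have := Real.sqrt_nonneg (V ω)
          simp only [hA, Set.mem_ofPred_eq]; linarith
        rw [this]; simpa using (Real.exp_pos _).le
      · push Not at hEt
        set a := √E
        set b := √(2 * t)
        have ha2 : a ^ 2 = E := Real.sq_sqrt hE0
        have hb2 : b ^ 2 = 2 * t := Real.sq_sqrt (by positivity)
        have hb : 0 < b := Real.sqrt_pos.2 (by positivity)
        have ha : 0 < a := hb.trans hEt
        have hsub : Aᶜ ⊆ {ω | V ω ≤ (a - b) ^ 2} := by
          intro ω hω
          simp only [hA, Set.mem_compl_iff, Set.mem_ofPred_eq, not_le] at hω ⊢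
          rw [← Real.sq_sqrt (h0 ω)]
          exact pow_le_pow_left₀ (Real.sqrt_nonneg _) (by linarith) 2
        -- Chernoff's bound is used at -x, x = b/a. With e^{-x} ≤ 1 - x + x²/2 the exponent is at
        -- most -3b²/2 + b³/a, which is at most -b²/2 = -t because b ≤ a.
        have hl : 0 ≤ b / a := by positivity
        have hexp : Real.exp (-(b / a)) ≤ 1 - b / a + (b / a) ^ 2 / 2 := by
          have := Real.quadratic_le_exp_of_nonneg hl
          rw [Real.exp_neg, inv_le_comm₀ (Real.exp_pos _) (by nlinarith [sq_nonneg (b / a - 1)])]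
          refine le_trans ?_ this
          -- (1 + x + x²/2)(1 - x + x²/2) = 1 + x⁴/4 ≥ 1.
          rw [inv_le_iff_one_le_mul₀ (by nlinarith [sq_nonneg (b / a - 1)])]
          nlinarith [sq_nonneg (b / a), sq_nonneg ((b / a) ^ 2)]
        refine (measureReal_mono hsub).trans ?_
        refine (measure_le_le_exp_mul_mgf _ (neg_nonpos.2 hl) (hint _)).trans ?_
        refine (mul_le_mul_of_nonneg_left (hmgf _) (Real.exp_pos _).le).trans ?_
        rw [← Real.exp_add, Real.exp_le_exp]
        have h1 := mul_le_mul_of_nonneg_right hexp hE0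
        have h2 : (b / a) * a = b := by field_simp
        have h3 : b / a ≤ 1 := (div_le_one ha).2 hEt.le
        have h4 : (b / a) * (a - b) ^ 2 = b * a - 2 * b ^ 2 + b ^ 2 * (b / a) := by
          field_simp; ring
        have h5 : (b / a) ^ 2 * E = b ^ 2 := by rw [← ha2]; field_simp
        have h6 : (b / a) * E = b * a := by rw [← ha2]; field_simp
        have h7 := mul_le_mul_of_nonneg_left h3 (sq_nonneg b)
        rw [neg_neg, h4]
        nlinarith
    -- Subadditivity suffices, so A need not be measurable.
    have h1 : 1 ≤ P.real A + P.real Aᶜ := by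
      have := measureReal_union_le (μ := P) A Aᶜ
      rwa [Set.union_compl_self, probReal_univ] at this
    linarith
  · have hsub : {ω | V ω - 2 * E > t} ⊆ {ω | 2 * E + t ≤ V ω} := by
      intro ω hω
      simp only [Set.mem_ofPred_eq] at hω ⊢
      linarith
    refine (measureReal_mono hsub).trans ?_
    refine (measure_ge_le_exp_mul_mgf _ (by norm_num : (0 : ℝ) ≤ 6 / 7) (hint _)).trans ?_
    refine (mul_le_mul_of_nonneg_left (hmgf _) (Real.exp_pos _).le).trans ?_
    rw [← Real.exp_add, Real.exp_le_exp]
    -- e^{6/7} - 1 ≤ 12/7 makes the coefficient of E in the exponent nonpositive, leaving -6t/7.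
    have he : Real.exp (6 / 7) ≤ 19 / 7 := by
      have h1 : Real.exp (6 / 7) * Real.exp (1 / 7) = Real.exp 1 := by
        rw [← Real.exp_add]; norm_num
      have h2 := Real.add_one_le_exp (1 / 7 : ℝ)
      nlinarith [Real.exp_one_lt_d9, Real.exp_pos (6 / 7)]
    nlinarith

/-- The convexity estimate behind the modified logarithmic Sobolev inequality. -/
theorem exp_neg_mul_le_of_mem_Icc {l v : ℝ} (h0 : 0 ≤ v) (h1 : v ≤ 1) :
    Real.exp (-(l * v)) ≤ 1 - v + v * Real.exp (-l) := by
  have := convexOn_exp.2 (Set.mem_univ (0 : ℝ)) (Set.mem_univ (-l)) (sub_nonneg.2 h1) h0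
    (by ring)
  simpa [mul_comm] using this

/-! ### Self-bounding functions and their moment generating function. -/

section SelfBounding

variable {ι α : Type*} [Fintype ι] [DecidableEq ι]

/-- A self-bounding function with values in `ℕ`: it exceeds by at most one, in each coordinate `k`,
a function `f' k` that does not depend on this coordinate, and these excesses add up to at most the
value of the function. -/
structure IsSelfBounding (f : (ι → α) → ℕ) (f' : ι → (ι → α) → ℕ) : Prop where
  update : ∀ k x y, f' k (Function.update x k y) = f' k x
  le : ∀ k x, f' k x ≤ f x
  le_add_one : ∀ k x, f x ≤ f' k x + 1
  sum_le : ∀ x, ∑ k, ((f x : ℝ) - f' k x) ≤ f x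

variable [MeasurableSpace α] {μ : Measure α} [IsProbabilityMeasure μ]
  {f : (ι → α) → ℕ} {f' : ι → (ι → α) → ℕ} {g : (ι → α) → ℝ}

/-- If a bounded measurable `g` agrees almost everywhere with a self-bounding function, then the
integer part of its coordinate mean is a measurable substitute for the lower function. -/
theorem IsSelfBounding.ae_floor_coordMean (hf : IsSelfBounding f f') (hg : IsBoundedMeasurable g)
    (hgf : (fun x => (f x : ℝ)) =ᵐ[Measure.pi fun _ : ι => μ] g) (k : ι) :
    ∀ᵐ x ∂(Measure.pi fun _ : ι => μ), (f' k x : ℝ) ≤ ⌊coordMean μ k g x⌋ ∧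
      (⌊coordMean μ k g x⌋ : ℝ) ≤ g x := by
  have hp := measurePreserving_update_pi μ k
  have hslice : ∀ᵐ x ∂(Measure.pi fun _ : ι => μ), ∀ᵐ y ∂μ,
      (f (Function.update x k y) : ℝ) = g (Function.update x k y) :=
    Measure.ae_ae_of_ae_prod (hp.quasiMeasurePreserving.ae hgf)
  have hkey : ∀ᵐ x ∂(Measure.pi fun _ : ι => μ), (f' k x : ℝ) ≤ ⌊coordMean μ k g x⌋ ∧
      ∀ᵐ y ∂μ, (⌊coordMean μ k g x⌋ : ℝ) ≤ g (Function.update x k y) := by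
    filter_upwards [hslice] with x hx
    have hi := (isBoundedMeasurable_comp_update k hg x).integrable μ
    have hlow : ∀ᵐ y ∂μ, (f' k x : ℝ) ≤ g (Function.update x k y) := by
      filter_upwards [hx] with y hy
      rw [← hy, ← hf.update k x y]
      exact_mod_cast hf.le k _
    have hup : ∀ᵐ y ∂μ, g (Function.update x k y) ≤ (f' k x : ℝ) + 1 := by
      filter_upwards [hx] with y hy
      rw [← hy, ← hf.update k x y]
      exact_mod_cast hf.le_add_one k _
    have hml : (f' k x : ℝ) ≤ coordMean μ k g x := by
      simpa [coordMean] using integral_mono_ae (integrable_const _) hi hlow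
    have hmu : coordMean μ k g x ≤ (f' k x : ℝ) + 1 := by
      simpa [coordMean] using integral_mono_ae hi (integrable_const _) hup
    have hfl : ((f' k x : ℤ)) ≤ ⌊coordMean μ k g x⌋ := Int.le_floor.2 (by exact_mod_cast hml)
    refine ⟨by exact_mod_cast hfl, ?_⟩
    -- The integer part is f' unless the mean is f' + 1; in that case g = f' + 1 almost everywhere
    -- on the slice, and the integer part still does not exceed g.
    rcases hmu.eq_or_lt with heq | hlt
    · have hz : ∀ᵐ y ∂μ, (f' k x : ℝ) + 1 - g (Function.update x k y) = 0 := by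
        refine (integral_eq_zero_iff_of_nonneg_ae ?_ ((integrable_const _).sub hi)).1 ?_
        · filter_upwards [hup] with y hy using sub_nonneg.2 hy
        · have : ∫ y, g (Function.update x k y) ∂μ = (f' k x : ℝ) + 1 := heq
          simp [integral_sub (integrable_const _) hi, this]
      filter_upwards [hz] with y hy
      linarith [Int.floor_le (coordMean μ k g x)]
    · have : ⌊coordMean μ k g x⌋ = (f' k x : ℤ) :=
        Int.floor_eq_iff.2 ⟨by exact_mod_cast hml, by exact_mod_cast hlt⟩
      rw [this]
      simpa using hlow
  have hm : Measurable fun x => (⌊coordMean μ k g x⌋ : ℝ) :=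
    measurable_from_top.comp (measurable_coordMean k hg.1).floor
  have hset : MeasurableSet {x | (⌊coordMean μ k g x⌋ : ℝ) ≤ g x} := measurableSet_le hm hg.1
  -- The integer part ignores coordinate k and resampling preserves the measure, so the bound on
  -- almost every slice is a bound almost everywhere.
  have hle : ∀ᵐ x ∂(Measure.pi fun _ : ι => μ), (⌊coordMean μ k g x⌋ : ℝ) ≤ g x := by
    rw [← hp.map_eq]
    refine (ae_map_iff hp.measurable.aemeasurable hset).2
      ((Measure.ae_prod_iff_ae_ae (hp.measurable hset)).2 ?_)
    filter_upwards [hkey] with x hx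
    filter_upwards [hx.2] with y hy
    simpa only [coordMean_update] using hy
  filter_upwards [hkey, hle] with x hx hx' using ⟨hx.1, hx'⟩

/-- Tensorization with Y = e^{lg}, c_k = e^{lm}, m the integer part of the k-th mean, gives the
terms e^{lg} φ(l(g - m)), φ(u) = e^{-u} + u - 1. By convexity φ(lv) ≤ v φ(l) on [0, 1], and the g -
m sum to at most g. -/
theorem IsSelfBounding.entropy_exp_le (hf : IsSelfBounding f f') (hg : Measurable g) {N : ℕ}
    (hgN : ∀ x, g x ∈ Set.Icc (0 : ℝ) N)
    (hgf : (fun x => (f x : ℝ)) =ᵐ[Measure.pi fun _ : ι => μ] g) (l : ℝ) :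
    l * ∫ x, g x * Real.exp (l * g x) ∂(Measure.pi fun _ : ι => μ) -
      (∫ x, Real.exp (l * g x) ∂(Measure.pi fun _ : ι => μ)) *
        Real.log (∫ x, Real.exp (l * g x) ∂(Measure.pi fun _ : ι => μ)) ≤
      (Real.exp (-l) + l - 1) * ∫ x, g x * Real.exp (l * g x) ∂(Measure.pi fun _ : ι => μ) := by
  have bg := IsBoundedMeasurable.of_mem_Icc hg hgN
  have hmN : ∀ k x, (⌊coordMean μ k g x⌋ : ℝ) ∈ Set.Icc (0 : ℝ) N := fun k x => by
    have h := coordMean_mem_Icc (μ := μ) k hg hgN x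
    exact ⟨by exact_mod_cast Int.floor_nonneg.2 h.1, (Int.floor_le _).trans h.2⟩
  have hexp : ∀ u : ℝ, u ∈ Set.Icc (0 : ℝ) N →
      Real.exp (l * u) ∈ Set.Icc (Real.exp (-(|l| * N))) (Real.exp (|l| * N)) := fun u hu => by
    have h1 : |l * u| ≤ |l| * N := by
      rw [abs_mul, abs_of_nonneg hu.1]
      exact mul_le_mul_of_nonneg_left hu.2 (abs_nonneg l)
    exact ⟨Real.exp_le_exp.2 (abs_le.1 h1).1, Real.exp_le_exp.2 (abs_le.1 h1).2⟩
  have hm : ∀ k, Measurable fun x => (⌊coordMean μ k g x⌋ : ℝ) := fun k =>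
    measurable_from_top.comp (measurable_coordMean k hg).floor
  have hY : Measurable fun x => Real.exp (l * g x) := (hg.const_mul l).exp
  have hc : ∀ k, Measurable fun x => Real.exp (l * ⌊coordMean μ k g x⌋) := fun k =>
    ((hm k).const_mul l).exp
  have hYab := fun x => hexp _ (hgN x)
  have hcab := fun k x => hexp _ (hmN k x)
  have bY := IsBoundedMeasurable.of_mem_Icc hY hYab
  have bc := fun k => IsBoundedMeasurable.of_mem_Icc (hc k) (hcab k)
  have hent := entropy_le_sum (μ := μ) hY (Real.exp_pos _) hYab hc hcab
    fun k x y => by simp only [coordMean_update]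
  simp only [Real.log_exp] at hent
  have hleft : ∫ x, Real.exp (l * g x) * (l * g x) ∂(Measure.pi fun _ : ι => μ) =
      l * ∫ x, g x * Real.exp (l * g x) ∂(Measure.pi fun _ : ι => μ) := by
    rw [← integral_const_mul]
    exact integral_congr_ae (ae_of_all _ fun x => by ring)
  rw [hleft] at hent
  refine hent.trans ?_
  have hint : ∀ k, Integrable (fun x => Real.exp (l * g x) * (l * g x - l * ⌊coordMean μ k g x⌋) -
      Real.exp (l * g x) + Real.exp (l * ⌊coordMean μ k g x⌋)) (Measure.pi fun _ : ι => μ) :=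
    fun k => by
      have bl : IsBoundedMeasurable fun _ : ι → α => l := ⟨measurable_const, |l|, fun _ => le_rfl⟩
      exact (((bY.mul ((bl.mul bg).sub (bl.mul (.of_mem_Icc (hm k) (hmN k))))).sub bY).add
        (bc k)).integrable _
  rw [← integral_finsetSum _ fun k _ => hint k, ← integral_const_mul]
  refine integral_mono_ae (integrable_finsetSum _ fun k _ => hint k)
    (((bg.mul bY).integrable _).const_mul _) ?_
  have hall := ae_all_iff.2 fun k => hf.ae_floor_coordMean bg hgf k
  filter_upwards [hall, hgf] with x hx hfx
  have hphi : 0 ≤ Real.exp (-l) + l - 1 := by linarith [Real.add_one_le_exp (-l)]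
  have hterm : ∀ k, Real.exp (l * g x) * (l * g x - l * ⌊coordMean μ k g x⌋) -
      Real.exp (l * g x) + Real.exp (l * ⌊coordMean μ k g x⌋) ≤
      Real.exp (l * g x) * (Real.exp (-l) + l - 1) * ((f x : ℝ) - f' k x) := fun k => by
    have hle1 : (f x : ℝ) ≤ f' k x + 1 := by exact_mod_cast hf.le_add_one k x
    obtain ⟨h1, h2⟩ := hx k
    set m : ℝ := (⌊coordMean μ k g x⌋ : ℝ)
    have h3 := exp_neg_mul_le_of_mem_Icc (l := l) (v := g x - m) (by linarith) (by linarith)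
    have h4 : Real.exp (l * m) = Real.exp (l * g x) * Real.exp (-(l * (g x - m))) := by
      rw [← Real.exp_add]; congr 1; ring
    have h5 : Real.exp (l * g x) * (l * g x - l * m) - Real.exp (l * g x) + Real.exp (l * m) ≤
        Real.exp (l * g x) * (Real.exp (-l) + l - 1) * (g x - m) := by
      rw [h4]
      nlinarith [mul_le_mul_of_nonneg_left h3 (Real.exp_pos (l * g x)).le]
    refine h5.trans (mul_le_mul_of_nonneg_left (by linarith) ?_)
    exact mul_nonneg (Real.exp_pos _).le hphi
  calc _ ≤ ∑ k, Real.exp (l * g x) * (Real.exp (-l) + l - 1) * ((f x : ℝ) - f' k x) :=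
        Finset.sum_le_sum fun k _ => hterm k
    _ = Real.exp (l * g x) * (Real.exp (-l) + l - 1) * ∑ k, ((f x : ℝ) - f' k x) := by
        rw [Finset.mul_sum]
    _ ≤ Real.exp (l * g x) * (Real.exp (-l) + l - 1) * g x :=
        mul_le_mul_of_nonneg_left (hfx ▸ hf.sum_le x) (mul_nonneg (Real.exp_pos _).le hphi)
    _ = _ := by ring

/-- The moment generating function of a self-bounding function of independent variables is at most
that of the Poisson law with the same mean. -/
theorem IsSelfBounding.mgf_le (hf : IsSelfBounding f f') {N : ℕ} (hfN : ∀ x, f x ≤ N)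
    (hmeas : AEMeasurable (fun x => (f x : ℝ)) (Measure.pi fun _ : ι => μ)) (l : ℝ) :
    mgf (fun x => (f x : ℝ)) (Measure.pi fun _ : ι => μ) l ≤
      Real.exp ((Real.exp l - 1) * ∫ x, (f x : ℝ) ∂(Measure.pi fun _ : ι => μ)) := by
  set ν := Measure.pi fun _ : ι => μ with hν
  obtain ⟨g, hg, hgN, hgf⟩ : ∃ g : (ι → α) → ℝ, Measurable g ∧
      (∀ x, g x ∈ Set.Icc (0 : ℝ) N) ∧ (fun x => (f x : ℝ)) =ᵐ[ν] g := by
    -- Truncation to [0, N] bounds the measurable version everywhere without changing it where it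
    -- equals f.
    refine ⟨fun x => max 0 (min (hmeas.mk _ x) N),
      measurable_const.max (hmeas.measurable_mk.min measurable_const), fun x =>
      ⟨le_max_left _ _, max_le (Nat.cast_nonneg N) (min_le_right _ _)⟩, ?_⟩
    filter_upwards [hmeas.ae_eq_mk] with x hx
    have h1 : (f x : ℝ) ≤ N := by exact_mod_cast hfN x
    rw [← hx, min_eq_left h1, max_eq_right (Nat.cast_nonneg _)]
  rw [mgf_congr hgf, integral_congr_ae hgf]
  have hI : ∀ s : ℝ, Integrable (fun x => Real.exp (s * g x)) ν := fun s =>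
    integrable_exp_mul_of_mem_Icc hg.aemeasurable (ae_of_all _ hgN)
  have hset : integrableExpSet g ν = Set.univ := Set.eq_univ_of_forall hI
  have hpos : ∀ s, 0 < mgf g ν s := fun s => mgf_pos (hI s)
  have hd : ∀ s, HasDerivAt (cgf g ν) (ν[fun x => g x * Real.exp (s * g x)] / mgf g ν s) s :=
    fun s => (hasDerivAt_mgf (by simp [hset])).log (hpos s).ne'
  have h := le_exp_sub_one_mul_of_deriv_le hd (by simp [cgf_zero]) (fun s => by
    rw [mul_div_assoc', div_le_iff₀ (hpos s)]
    have := hf.entropy_exp_le hg hgN hgf s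
    simp only [cgf, mgf]
    linarith) l
  simp only [zero_mul, Real.exp_zero, mul_one, mgf_zero, div_one] at h
  rw [← Real.exp_log (hpos l)]
  exact Real.exp_le_exp.2 h

end SelfBounding

/-! ### The local packing number is self-bounding. -/

section LocalPacking

variable {𝒳 : Type*} (d : 𝒳 → 𝒳 → ℝ) (r : ℝ) {n : ℕ}

/-- The length of the longest locally separated subsequence of `x` that avoids the index `k`. -/
noncomputable def localPackingNumberAvoiding (k : Fin n) (x : Fin n → 𝒳) : ℕ :=
  sSup {m | ∃ σ : Fin m ↪o Fin n, (∀ i, σ i ≠ k) ∧ IsLocallySeparated d r (x ∘ σ)}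

variable {d r}

theorem IsLocallySeparated.comp {k m : ℕ} {s : Fin k → 𝒳} (hs : IsLocallySeparated d r s)
    (τ : Fin m ↪o Fin k) : IsLocallySeparated d r (s ∘ τ) :=
  ⟨hs.1.imp fun _ h i => h (τ i), fun _ _ hij => hs.2 _ _ (τ.lt_iff_lt.2 hij)⟩

theorem card_le_of_orderEmbedding {m : ℕ} (σ : Fin m ↪o Fin n) : m ≤ n := by
  simpa using Fintype.card_le_of_injective σ σ.injective

theorem le_localPackingNumberAvoiding {k : Fin n} {x : Fin n → 𝒳} {m : ℕ} (σ : Fin m ↪o Fin n)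
    (hσ : ∀ i, σ i ≠ k) (hs : IsLocallySeparated d r (x ∘ σ)) :
    m ≤ localPackingNumberAvoiding d r k x := by
  refine le_csSup ⟨n, ?_⟩ ⟨σ, hσ, hs⟩
  rintro m ⟨σ, -⟩
  exact card_le_of_orderEmbedding σ

theorem localPackingNumberAvoiding_update (k : Fin n) (x : Fin n → 𝒳) (y : 𝒳) :
    localPackingNumberAvoiding d r k (Function.update x k y) =
      localPackingNumberAvoiding d r k x := by
  unfold localPackingNumberAvoiding
  congr 1
  ext m
  refine exists_congr fun σ => and_congr_right fun hσ => ?_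
  rw [show Function.update x k y ∘ σ = x ∘ σ from
    funext fun i => Function.update_of_ne (hσ i) _ _]

variable [Nonempty 𝒳]

theorem localPackingNumberAvoiding_le (k : Fin n) (x : Fin n → 𝒳) :
    localPackingNumberAvoiding d r k x ≤ localPackingNumber d x r := by
  refine csSup_le ⟨0, OrderEmbedding.ofIsEmpty, fun i => i.elim0,
    ⟨Classical.arbitrary 𝒳, fun i => i.elim0⟩, fun i => i.elim0⟩ ?_
  rintro m ⟨σ, -, hs⟩
  exact (localPackingNumber_isGreatest d x r).2 ⟨σ, hs⟩

/-- Local separation passes to subsequences, so removing index k from a longest one costs a single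
entry. -/
theorem localPackingNumber_le_add_one (k : Fin n) (x : Fin n → 𝒳) :
    localPackingNumber d x r ≤ localPackingNumberAvoiding d r k x + 1 := by
  obtain ⟨σ, hs⟩ := (localPackingNumber_isGreatest d x r).1
  by_cases hk : ∃ i, σ i = k
  · generalize localPackingNumber d x r = h at σ hs hk
    obtain ⟨i, rfl⟩ := hk
    obtain _ | m := h
    · exact i.elim0
    · refine Nat.succ_le_succ (le_localPackingNumberAvoiding
        ((Fin.succAboveOrderEmb i).trans σ) (fun j h => ?_) (hs.comp (Fin.succAboveOrderEmb i)))
      exact Fin.succAbove_ne i j (σ.injective h)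
  · push Not at hk
    exact (le_localPackingNumberAvoiding σ hk hs).trans (Nat.le_succ _)

/-- Fix a longest subsequence. An index outside it contributes nothing, since the subsequence avoids
that index; each index in it contributes at most one. -/
theorem sum_localPackingNumber_sub_le (x : Fin n → 𝒳) :
    ∑ k, ((localPackingNumber d x r : ℝ) - localPackingNumberAvoiding d r k x) ≤
      localPackingNumber d x r := by
  obtain ⟨σ, hs⟩ := (localPackingNumber_isGreatest d x r).1
  classical
  have hle : ∀ k, (localPackingNumber d x r : ℝ) - localPackingNumberAvoiding d r k x ≤
      if k ∈ Finset.univ.map σ.toEmbedding then 1 else 0 := fun k => by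
    split_ifs with hk
    · have : (localPackingNumber d x r : ℝ) ≤ localPackingNumberAvoiding d r k x + 1 := by
        exact_mod_cast localPackingNumber_le_add_one k x
      linarith
    · have : (localPackingNumber d x r : ℝ) ≤ localPackingNumberAvoiding d r k x := by
        exact_mod_cast le_localPackingNumberAvoiding σ (fun i hi => hk (by simp [← hi])) hs
      linarith
  refine (Finset.sum_le_sum fun k _ => hle k).trans (le_of_eq ?_)
  rw [Finset.sum_ite_mem, Finset.univ_inter]
  simp

theorem isSelfBounding_localPackingNumber :
    IsSelfBounding (fun x : Fin n → 𝒳 => localPackingNumber d x r)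
      (localPackingNumberAvoiding d r) where
  update := localPackingNumberAvoiding_update
  le := localPackingNumberAvoiding_le
  le_add_one := localPackingNumber_le_add_one
  sum_le := sum_localPackingNumber_sub_le

theorem localPackingNumber_le (x : Fin n → 𝒳) : localPackingNumber d x r ≤ n := by
  obtain ⟨σ, -⟩ := (localPackingNumber_isGreatest d x r).1
  exact card_le_of_orderEmbedding σ

end LocalPacking

/-! ### Transfer to the i.i.d. sample. -/

theorem corollary3 {Ω 𝒳 : Type*}
    -- a Hausdorff space with a Borel probability measure
    [TopologicalSpace 𝒳] [T2Space 𝒳] [MeasurableSpace 𝒳] [BorelSpace 𝒳]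
    (μ : Measure 𝒳) [IsProbabilityMeasure μ]
    -- a continuous distortion function
    (d : 𝒳 → 𝒳 → ℝ) (hd_cont : Continuous fun p : 𝒳 × 𝒳 => d p.1 p.2)
    (hd_nonneg : ∀ x y, 0 ≤ d x y) (hd_self : ∀ x, d x x = 0) (hd_symm : ∀ x y, d x y = d y x)
    -- an i.i.d. sample with law `μ`
    [MeasurableSpace Ω] (P : Measure Ω) [IsProbabilityMeasure P]
    (n : ℕ) (X : Fin n → Ω → 𝒳) (hX : ∀ i, Measurable (X i))
    (hX_law : ∀ i, P.map (X i) = μ) (hX_indep : iIndepFun X P)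
    -- a radius, at which `h` is measurable on the completed product space
    (r : ℝ) (hr : 0 ≤ r)
    (h_meas : AEMeasurable (fun x : Fin n → 𝒳 => (localPackingNumber d x r : ℝ))
      (Measure.pi fun _ => μ))
    (t : ℝ) (ht : 0 < t) :
    Integrable (fun ω => (localPackingNumber d (fun i => X i ω) r : ℝ)) P ∧
    1 - Real.exp (-t) ≤
      P.real {ω | √(∫ ω', (localPackingNumber d (fun i => X i ω') r : ℝ) ∂P) ≤
        √(localPackingNumber d (fun i => X i ω) r : ℝ) + √(2 * t)} ∧
    P.real {ω | (localPackingNumber d (fun i => X i ω) r : ℝ) -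
        2 * ∫ ω', (localPackingNumber d (fun i => X i ω') r : ℝ) ∂P > t} ≤
      Real.exp (-(6 * t / 7)) := by
  have : Nonempty 𝒳 := nonempty_of_isProbabilityMeasure μ
  have hXm : AEMeasurable (fun ω i => X i ω) P := (measurable_pi_lambda _ hX).aemeasurable
  have hmap : P.map (fun ω i => X i ω) = Measure.pi fun _ => μ := by
    rw [(iIndepFun_iff_map_fun_eq_pi_map fun i => (hX i).aemeasurable).1 hX_indep]
    simp only [hX_law]
  rw [← hmap] at h_meas
  have hV : AEMeasurable (fun ω => (localPackingNumber d (fun i => X i ω) r : ℝ)) P :=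
    h_meas.comp_aemeasurable hXm
  have hVn : ∀ᵐ ω ∂P, (localPackingNumber d (fun i => X i ω) r : ℝ) ∈ Set.Icc (0 : ℝ) n :=
    ae_of_all _ fun ω => ⟨Nat.cast_nonneg _, by exact_mod_cast localPackingNumber_le _⟩
  refine ⟨Integrable.of_mem_Icc 0 n hV hVn, poissonian_tails (fun _ => Nat.cast_nonneg _)
    (fun l => integrable_exp_mul_of_mem_Icc hV hVn) (fun l => ?_) ht⟩
  have h := (isSelfBounding_localPackingNumber (d := d) (r := r) (n := n)).mgf_le
    (μ := μ) localPackingNumber_le (hmap ▸ h_meas) l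
  rw [← hmap, integral_map hXm h_meas.aestronglyMeasurable, mgf_map hXm ?_] at h
  · exact h
  · exact (Real.measurable_exp.comp_aemeasurable (h_meas.const_mul l)).aestronglyMeasurable
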